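/- Let $q,a,b$ be nonzero complex numbers with $|q|<1$ and $\max\{|a|,|b|,|ab/q|\}<1$, let $\omega=e^{2\pi i/3}$, and let $q^{1/2}$ be any square root of $q$. Write $(x;q)_n=\prod_{k=0}^{n-1}(1-xq^k)$ for $n\in\{0,1,2,\dots\}\cup\{\infty\}$ and $(x_1,\dots,x_m;q)_n=(x_1;q)_n\cdots(x_m;q)_n$. Then the four series below converge absolutely, and \begin{align*} &\frac{(q,ab/q;q)_\infty}{(a,b;q)_\infty}\sum_{n=0}^{\infty}\frac{(q/a,q/b,\omega,\omega^2;q)_n}{(q,-1,q^{1/2},-q^{1/2};q)_n}\left(\frac{ab}{q}\right)^n\\ &\quad=1+\sum_{n=1}^{\infty}(-1)^n(1+q^{3n})\frac{(q/a,q/b;q)_{3n}}{(a,b;q)_{3n}}a^{3n}b^{3n}q^{\frac{9n^2-9n}{2}}\\ &\qquad+\frac{q^2}{2}\sum_{n=1}^{\infty}(-1)^n(1+q^{3n-1})\frac{(q/a,q/b;q)_{3n-1}}{(a,b;q)_{3n-1}}a^{3n-1}b^{3n-1}q^{\frac{9n^2-15n}{2}}\\ &\qquad+\frac{1}{2q}\sum_{n=0}^{\infty}(-1)^n(1+q^{3n+1})\frac{(q/a,q/b;q)_{3n+1}}{(a,b;q)_{3n+1}}a^{3n+1}b^{3n+1}q^{\frac{9n^2-3n}{2}}.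 \end{align*} -/

import Mathlib

noncomputable section

/-- The finite `q`-shifted factorial `(a; q)_n = ∏_{k=0}^{n-1} (1 - a q^k)`. -/
def qPoch (a q : ℂ) (n : ℕ) : ℂ := ∏ k ∈ Finset.range n, (1 - a * q ^ k)

/-- The infinite `q`-shifted factorial `(a; q)_∞ = ∏_{k=0}^∞ (1 - a q^k)`, used for `|q| < 1`. -/
def qPochInf (a q : ℂ) : ℂ := ∏' k : ℕ, (1 - a * q ^ k)

/-- The product in `qPochInf` converges for `|q| < 1`. -/
theorem multipliable_qPochInf (a q : ℂ) (hq : ‖q‖ < 1) :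
    Multipliable (fun k : ℕ => 1 - a * q ^ k) := by
  have h : Summable (fun k : ℕ => ‖-(a * q ^ k)‖) := by
    simp only [norm_neg, norm_mul, norm_pow]
    exact (summable_geometric_of_lt_one (norm_nonneg q) hq).mul_left _
  simpa [sub_eq_add_neg] using multipliable_one_add_of_summable h

/-- `(a; q)_∞` is the limit of `(a; q)_n` for `|q| < 1`. -/
theorem tendsto_qPoch (a q : ℂ) (hq : ‖q‖ < 1) :
    Filter.Tendsto (qPoch a q) Filter.atTop (nhds (qPochInf a q)) :=
  (multipliable_qPochInf a q hq).tendsto_prod_tprod_nat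

/-- The compact notation `(a₁, …, a_m; q)_n = (a₁; q)_n ⋯ (a_m; q)_n`. -/
def qPochs (l : List ℂ) (q : ℂ) (n : ℕ) : ℂ := (l.map fun a => qPoch a q n).prod

/-- The compact notation `(a₁, …, a_m; q)_∞ = (a₁; q)_∞ ⋯ (a_m; q)_∞`. -/
def qPochsInf (l : List ℂ) (q : ℂ) : ℂ := (l.map fun a => qPochInf a q).prod

/-- The `n`-th term of the series on the left-hand side; `s` is a square root of `q`. -/
def lhsTerm (q s a b ω : ℂ) (n : ℕ) : ℂ :=
  qPochs [q / a, q / b, ω, ω ^ 2] q n / qPochs [q, -1, s, -s] q n * (a * b / q) ^ n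

/-- The common factor
`(1 + q^m) (q/a, q/b; q)_m / (a, b; q)_m · a^m b^m` of the terms on the right-hand side. -/
def rhsFactor (q a b : ℂ) (m : ℕ) : ℂ :=
  (1 + q ^ m) * (qPochs [q / a, q / b] q m / qPochs [a, b] q m) * a ^ m * b ^ m

end

/-!
A finite form of Jacobi's triple product identity expresses `(z; q)_n (q / z; q)_n / (q; q)_{2n}`
as a sum of theta terms over `-n ≤ r ≤ n`; pairing `±r` gives a Bailey pair relative to `1`.
Averaging over `z ↔ z⁻¹` turns the product into `(z, z⁻¹; q)_n / (q, -1, q^{1/2}, -q^{1/2}; q)_n`.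
Bailey's lemma, with the conjugate Bailey pair given by the `q`-Gauss sum and the parameters `q / a`
and `q / b`, then evaluates the series on the left-hand side as a single sum over `m` in which `z`
enters only through `z ^ m + z⁻¹ ^ m`. At `z = ω` this factor is `2` if `3 ∣ m` and `-1` otherwise,
and sorting the sum by the residue of `m` modulo `3` gives the right-hand side.
-/

open Filter Finset Topology

theorem qPoch_zero (a q : ℂ) : qPoch a q 0 = 1 := prod_range_zero _

theorem qPoch_succ (a q : ℂ) (n : ℕ) : qPoch a q (n + 1) = qPoch a q n * (1 - a * q ^ n) :=
  prod_range_succ _ _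

theorem qPoch_add (a q : ℂ) (m n : ℕ) :
    qPoch a q (m + n) = qPoch a q m * qPoch (a * q ^ m) q n := by
  simp only [qPoch, prod_range_add, pow_add, mul_assoc]

theorem qPoch_succ' (a q : ℂ) (n : ℕ) : qPoch a q (n + 1) = (1 - a) * qPoch (a * q) q n := by
  rw [add_comm, qPoch_add, qPoch_succ, qPoch_zero, pow_zero, pow_one, one_mul, mul_one]

theorem qPoch_ne_zero {a q : ℂ} (ha : ∀ k : ℕ, a * q ^ k ≠ 1) (n : ℕ) : qPoch a q n ≠ 0 :=
  prod_ne_zero_iff.2 fun k _ => sub_ne_zero.2 (ha k).symm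

theorem mul_pow_ne_one_of_norm_lt_one {a q : ℂ} (ha : ‖a‖ < 1) (hq : ‖q‖ ≤ 1) (k : ℕ) :
    a * q ^ k ≠ 1 := by
  intro h
  have hle : ‖a * q ^ k‖ ≤ ‖a‖ := by
    rw [norm_mul, norm_pow]
    exact mul_le_of_le_one_right (norm_nonneg a) (pow_le_one₀ (norm_nonneg q) hq)
  rw [h, norm_one] at hle
  exact hle.not_gt ha

theorem qPochInf_eq_qPoch_mul (a : ℂ) {q : ℂ} (hq : ‖q‖ < 1) (n : ℕ) :
    qPochInf a q = qPoch a q n * qPochInf (a * q ^ n) q := by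
  have hshift := (tendsto_qPoch a q hq).comp (tendsto_add_atTop_nat n)
  refine tendsto_nhds_unique hshift
    (((tendsto_qPoch (a * q ^ n) q hq).const_mul (qPoch a q n)).congr fun m => ?_)
  rw [Function.comp_apply, add_comm, qPoch_add]

theorem qPochInf_ne_zero {a q : ℂ} (hq : ‖q‖ < 1) (ha : ∀ k : ℕ, a * q ^ k ≠ 1) :
    qPochInf a q ≠ 0 := by
  have hsum : Summable fun k : ℕ => ‖-(a * q ^ k)‖ :=
    ((summable_geometric_of_norm_lt_one hq).mul_left a).neg.norm
  simpa only [qPochInf, sub_eq_add_neg] using tprod_one_add_ne_zero_of_summable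
    (fun k => by simpa only [← sub_eq_add_neg] using sub_ne_zero.2 (ha k).symm) hsum

theorem qPochs_nil (q : ℂ) (n : ℕ) : qPochs [] q n = 1 := rfl

theorem qPochs_cons (a : ℂ) (l : List ℂ) (q : ℂ) (n : ℕ) :
    qPochs (a :: l) q n = qPoch a q n * qPochs l q n := List.prod_cons

theorem qPochsInf_cons (a : ℂ) (l : List ℂ) (q : ℂ) :
    qPochsInf (a :: l) q = qPochInf a q * qPochsInf l q := List.prod_cons

theorem qPochs_zero (l : List ℂ) (q : ℂ) : qPochs l q 0 = 1 := by
  simp [qPochs, qPoch_zero]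

theorem qPochs_add (l : List ℂ) (q : ℂ) (m n : ℕ) :
    qPochs l q (m + n) = qPochs l q m * qPochs (l.map (· * q ^ m)) q n := by
  simp [qPochs, qPoch_add, List.prod_map_mul, Function.comp_def]

theorem qPochs_ne_zero {l : List ℂ} {q : ℂ} (hl : ∀ a ∈ l, ∀ k : ℕ, a * q ^ k ≠ 1) (n : ℕ) :
    qPochs l q n ≠ 0 := by
  refine List.prod_ne_zero fun h => ?_
  obtain ⟨a, ha, h⟩ := List.mem_map.1 h
  exact qPoch_ne_zero (hl a ha) n h

theorem qPochsInf_ne_zero {l : List ℂ} {q : ℂ} (hq : ‖q‖ < 1)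
    (hl : ∀ a ∈ l, ∀ k : ℕ, a * q ^ k ≠ 1) : qPochsInf l q ≠ 0 := by
  refine List.prod_ne_zero fun h => ?_
  obtain ⟨a, ha, h⟩ := List.mem_map.1 h
  exact qPochInf_ne_zero hq (hl a ha) h

theorem qPochsInf_eq_qPochs_mul (l : List ℂ) {q : ℂ} (hq : ‖q‖ < 1) (n : ℕ) :
    qPochsInf l q = qPochs l q n * qPochsInf (l.map (· * q ^ n)) q := by
  rw [qPochsInf, funext fun a => qPochInf_eq_qPoch_mul a hq n, List.prod_map_mul, qPochs,
    qPochsInf, List.map_map, Function.comp_def]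

theorem tendsto_qPochs (l : List ℂ) {q : ℂ} (hq : ‖q‖ < 1) :
    Tendsto (qPochs l q) atTop (𝓝 (qPochsInf l q)) :=
  tendsto_list_prod l fun a _ => tendsto_qPoch a q hq

theorem exists_norm_qPochs_le (l : List ℂ) {q : ℂ} (hq : ‖q‖ < 1) :
    ∃ K > 0, ∀ n, ‖qPochs l q n‖ ≤ K := by
  simpa only [Set.forall_mem_range] using
    (Metric.isBounded_range_of_tendsto _ (tendsto_qPochs l hq)).exists_pos_norm_le

theorem exists_norm_inv_qPochs_le {l : List ℂ} {q : ℂ} (hq : ‖q‖ < 1)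
    (hl : ∀ a ∈ l, ∀ k : ℕ, a * q ^ k ≠ 1) : ∃ K > 0, ∀ n, ‖(qPochs l q n)⁻¹‖ ≤ K := by
  simpa only [Set.forall_mem_range] using (Metric.isBounded_range_of_tendsto _
    ((tendsto_qPochs l hq).inv₀ (qPochsInf_ne_zero hq hl))).exists_pos_norm_le

/-- The `n`-th term of the basic hypergeometric series `₂φ₁(A, B; C; q, x)`. -/
noncomputable def phiTerm (q A B C x : ℂ) (n : ℕ) : ℂ :=
  qPochs [A, B] q n / qPochs [q, C] q n * x ^ n

theorem phiTerm_zero (q A B C x : ℂ) : phiTerm q A B C x 0 = 1 := by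
  simp [phiTerm, qPochs_zero]

section GaussSum

variable {q : ℂ} (A B : ℂ)

theorem phiTerm_succ {C : ℂ} (hqq : ∀ k : ℕ, q * q ^ k ≠ 1) (hC : ∀ k : ℕ, C * q ^ k ≠ 1) (x : ℂ)
    (n : ℕ) :
    (1 - q ^ (n + 1)) * (1 - C * q ^ n) * phiTerm q A B C x (n + 1)
      = (1 - A * q ^ n) * (1 - B * q ^ n) * x * phiTerm q A B C x n := by
  have hqn : 1 - q * q ^ n ≠ 0 := sub_ne_zero.2 (hqq n).symm
  have hCn : 1 - q ^ n * C ≠ 0 := sub_ne_zero.2 (mul_comm C _ ▸ hC n).symm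
  have hqpoch := qPoch_ne_zero hqq n
  have hCpoch := qPoch_ne_zero hC n
  simp only [phiTerm, qPochs_cons, qPochs_nil, qPoch_succ, pow_succ']
  field_simp

theorem phiTerm_mul_base {C : ℂ} (hC : ∀ k : ℕ, C * q ^ k ≠ 1) (x : ℂ) (n : ℕ) :
    (1 - C * q ^ n) * phiTerm q A B (C * q) (x * q) n
      = (1 - C) * q ^ n * phiTerm q A B C x n := by
  have hshift : (1 - C) * qPoch (C * q) q n = qPoch C q n * (1 - C * q ^ n) := by
    rw [← qPoch_succ', qPoch_succ]
  have hCn : 1 - C * q ^ n ≠ 0 := sub_ne_zero.2 (hC n).symm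
  have hC0 : 1 - C ≠ 0 := sub_ne_zero.2 (by simpa using (hC 0).symm)
  have hCpoch : qPoch (C * q) q n = qPoch C q n * (1 - C * q ^ n) / (1 - C) := by
    rw [← hshift, mul_div_cancel_left₀ _ hC0]
  simp only [phiTerm, qPochs_cons, qPochs_nil, hCpoch, mul_pow]
  field_simp

theorem exists_norm_phiTerm_le {C : ℂ} (hq : ‖q‖ < 1) (hC : ∀ k : ℕ, C * q ^ k ≠ 1) :
    ∃ K > 0, ∀ (N n : ℕ) (x : ℂ), ‖phiTerm q A B (C * q ^ N) x n‖ ≤ K * ‖x‖ ^ n := by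
  obtain ⟨K₁, hK₁, hAB⟩ := exists_norm_qPochs_le [A, B] hq
  obtain ⟨K₂, hK₂, hqinv⟩ := exists_norm_inv_qPochs_le (l := [q]) hq
    (by simpa using mul_pow_ne_one_of_norm_lt_one hq hq.le)
  obtain ⟨K₃, hK₃, hCN⟩ := exists_norm_qPochs_le [C] hq
  obtain ⟨K₄, hK₄, hCinv⟩ := exists_norm_inv_qPochs_le (l := [C]) hq (by simpa using hC)
  refine ⟨K₁ * (K₂ * (K₃ * K₄)), by positivity, fun N n x => ?_⟩
  have hshift : (qPoch (C * q ^ N) q n)⁻¹ = qPochs [C] q N * (qPochs [C] q (N + n))⁻¹ := by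
    simp only [qPochs_cons, qPochs_nil, mul_one]
    rw [qPoch_add, mul_inv, mul_inv_cancel_left₀ (qPoch_ne_zero hC N)]
  have hfactor : phiTerm q A B (C * q ^ N) x n = qPochs [A, B] q n
      * ((qPochs [q] q n)⁻¹ * (qPochs [C] q N * (qPochs [C] q (N + n))⁻¹)) * x ^ n := by
    rw [← hshift]
    simp only [phiTerm, qPochs_cons, qPochs_nil, mul_one, div_eq_mul_inv, mul_inv]
  rw [hfactor]
  simp only [norm_mul, norm_pow]
  gcongr
  exacts [hAB n, hqinv n, hCN N, hCinv (N + n)]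

theorem summable_phiTerm {C x : ℂ} (hq : ‖q‖ < 1) (hx : ‖x‖ < 1)
    (hC : ∀ k : ℕ, C * q ^ k ≠ 1) : Summable (phiTerm q A B C x) := by
  obtain ⟨K, -, hK⟩ := exists_norm_phiTerm_le A B hq hC
  exact .of_norm_bounded ((summable_geometric_of_lt_one (norm_nonneg x) hx).mul_left K)
    fun n => by simpa using hK 0 n x

theorem phiTerm_contiguous (x : ℂ) (hqq : ∀ k : ℕ, q * q ^ k ≠ 1)
    (hC : ∀ k : ℕ, A * B * x * q ^ k ≠ 1) (n : ℕ) :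
    (1 - A * B * x) * (1 - x) * phiTerm q A B (A * B * x) x n
        - (1 - A * x) * (1 - B * x) * phiTerm q A B (A * B * x * q) (x * q) n
      = (1 - A * B * x) * ((1 - q ^ n) * phiTerm q A B (A * B * x) x n
        - (1 - q ^ (n + 1)) * phiTerm q A B (A * B * x) x (n + 1)) := by
  refine mul_left_cancel₀ (sub_ne_zero.2 (hC n).symm) ?_
  linear_combination (1 - A * B * x) * phiTerm_succ A B hqq hC x n
    - (1 - A * x) * (1 - B * x) * phiTerm_mul_base A B hC x n

theorem tsum_phiTerm_contiguous {x : ℂ} (hq : ‖q‖ < 1) (hx : ‖x‖ < 1)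
    (hC : ∀ k : ℕ, A * B * x * q ^ k ≠ 1) :
    (1 - A * B * x) * (1 - x) * ∑' n, phiTerm q A B (A * B * x) x n
      = (1 - A * x) * (1 - B * x) * ∑' n, phiTerm q A B (A * B * x * q) (x * q) n := by
  have hsum := summable_phiTerm A B hq hx hC
  have hsum' : Summable (phiTerm q A B (A * B * x * q) (x * q)) := by
    refine summable_phiTerm A B hq ?_ fun k => ?_
    · rw [norm_mul]
      exact mul_lt_one_of_nonneg_of_lt_one_left (norm_nonneg x) hx hq.le
    · simpa [pow_succ', mul_assoc] using hC (k + 1)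
  let g : ℕ → ℂ := fun n => (1 - q ^ n) * phiTerm q A B (A * B * x) x n
  have hg : Tendsto g atTop (𝓝 0) := by
    simpa using ((tendsto_pow_atTop_nhds_zero_of_norm_lt_one hq).const_sub 1).mul
      hsum.tendsto_atTop_zero
  have htelescope : Tendsto (fun N => (1 - A * B * x) * (g 0 - g N)) atTop (𝓝 0) := by
    simpa [g] using (hg.const_sub (g 0)).const_mul (1 - A * B * x)
  have hdiff := ((hsum.hasSum.mul_left ((1 - A * B * x) * (1 - x))).sub
    (hsum'.hasSum.mul_left ((1 - A * x) * (1 - B * x)))).tendsto_sum_nat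
  refine sub_eq_zero.1 (tendsto_nhds_unique hdiff (htelescope.congr fun N => ?_))
  rw [← sum_range_sub', mul_sum]
  exact sum_congr rfl fun n _ => (phiTerm_contiguous A B x
    (mul_pow_ne_one_of_norm_lt_one hq hq.le) hC n).symm

theorem tsum_phiTerm_iterate {x : ℂ} (hq : ‖q‖ < 1) (hx : ‖x‖ < 1)
    (hC : ∀ k : ℕ, A * B * x * q ^ k ≠ 1) (N : ℕ) :
    qPochs [A * B * x, x] q N * ∑' n, phiTerm q A B (A * B * x) x n
      = qPochs [B * x, A * x] q N
        * ∑' n, phiTerm q A B (A * B * x * q ^ N) (x * q ^ N) n := by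
  induction N with
  | zero => simp [qPochs_zero]
  | succ N ih =>
    have hxN : ‖x * q ^ N‖ < 1 := by
      rw [norm_mul, norm_pow]
      exact mul_lt_one_of_nonneg_of_lt_one_left (norm_nonneg x) hx
        (pow_le_one₀ (norm_nonneg q) hq.le)
    have hstep := tsum_phiTerm_contiguous A B hq hxN fun k => by
      simpa [pow_add, mul_assoc] using hC (N + k)
    simp only [qPochs_cons, qPochs_nil, mul_one, qPoch_succ, pow_succ, ← mul_assoc] at ih hstep ⊢
    linear_combination (1 - A * B * x * q ^ N) * (1 - x * q ^ N) * ih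
      + qPoch (A * x) q N * qPoch (B * x) q N * hstep

theorem tendsto_tsum_phiTerm_mul_pow {C x : ℂ} (hq : ‖q‖ < 1) (hx : ‖x‖ < 1)
    (hC : ∀ k : ℕ, C * q ^ k ≠ 1) :
    Tendsto (fun N : ℕ => ∑' n, phiTerm q A B (C * q ^ N) (x * q ^ N) n) atTop (𝓝 1) := by
  obtain ⟨K, hK0, hK⟩ := exists_norm_phiTerm_le A B hq hC
  rw [← tsum_ite_eq (0 : ℕ) fun _ => (1 : ℂ)]
  refine tendsto_tsum_of_dominated_convergence
    ((summable_geometric_of_lt_one (norm_nonneg x) hx).mul_left K) (fun n => ?_)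
    (Eventually.of_forall fun N n => (hK N n _).trans ?_)
  · rcases eq_or_ne n 0 with rfl | hn
    · simp [phiTerm_zero]
    have hxN : Tendsto (fun N : ℕ => x * q ^ N) atTop (𝓝 0) := by
      simpa using (tendsto_pow_atTop_nhds_zero_of_norm_lt_one hq).const_mul x
    have hbound : Tendsto (fun N : ℕ => K * ‖x * q ^ N‖ ^ n) atTop (𝓝 0) := by
      simpa [hn] using (hxN.norm.pow n).const_mul K
    simpa [hn] using squeeze_zero_norm (fun N => hK N n _) hbound
  · gcongr
    rw [norm_mul, norm_pow]
    exact mul_le_of_le_one_right (norm_nonneg x) (pow_le_one₀ (norm_nonneg q) hq.le)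

theorem tsum_phiTerm_gauss {x : ℂ} (hq : ‖q‖ < 1) (hx : ‖x‖ < 1)
    (hC : ∀ k : ℕ, A * B * x * q ^ k ≠ 1) :
    qPochsInf [A * B * x, x] q * ∑' n, phiTerm q A B (A * B * x) x n
      = qPochsInf [B * x, A * x] q := by
  have hlhs := (tendsto_qPochs [A * B * x, x] hq).mul_const (∑' n, phiTerm q A B (A * B * x) x n)
  have hrhs := (tendsto_qPochs [B * x, A * x] hq).mul (tendsto_tsum_phiTerm_mul_pow A B hq hx hC)
  rw [mul_one] at hrhs
  exact tendsto_nhds_unique hlhs (hrhs.congr fun N => (tsum_phiTerm_iterate A B hq hx hC N).symm)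

end GaussSum

/-- `(α, β)` is a Bailey pair relative to `c`: `β_n = ∑_{r ≤ n} α_r / ((q; q)_{n-r} (cq; q)_{n+r})`.
The sum runs over the pairs `(r, n - r)`, so that no truncated subtraction occurs. -/
def IsBaileyPair (q c : ℂ) (α β : ℕ → ℂ) : Prop :=
  ∀ n, β n = ∑ p ∈ antidiagonal n, α p.1 / (qPoch q q p.2 * qPoch (c * q) q (2 * p.1 + p.2))

section BaileyLemma

variable {q c x : ℂ} (u v : ℂ) {α β : ℕ → ℂ}

theorem IsBaileyPair.add {α' β' : ℕ → ℂ} (h : IsBaileyPair q c α β)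
    (h' : IsBaileyPair q c α' β') : IsBaileyPair q c (α + α') (β + β') := fun n => by
  simp only [Pi.add_apply, h n, h' n, add_div, sum_add_distrib]

theorem IsBaileyPair.const_smul (t : ℂ) (h : IsBaileyPair q c α β) :
    IsBaileyPair q c (t • α) (t • β) := fun n => by
  simp only [Pi.smul_apply, smul_eq_mul, h n, mul_sum, mul_div_assoc]

theorem summable_bailey_double (hq : ‖q‖ < 1) (hx : ‖x‖ < 1) (hc : ∀ k : ℕ, c * q * q ^ k ≠ 1)
    (hα : Summable fun r => α r * x ^ r) :
    Summable fun p : ℕ × ℕ => qPochs [u, v] q (p.1 + p.2) * x ^ (p.1 + p.2)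
      * (α p.1 / (qPoch q q p.2 * qPoch (c * q) q (2 * p.1 + p.2))) := by
  obtain ⟨K₁, hK₁, huv⟩ := exists_norm_qPochs_le [u, v] hq
  obtain ⟨K₂, hK₂, hqinv⟩ := exists_norm_inv_qPochs_le (l := [q]) hq
    (by simpa using mul_pow_ne_one_of_norm_lt_one hq hq.le)
  obtain ⟨K₃, -, hcinv⟩ := exists_norm_inv_qPochs_le (l := [c * q]) hq (by simpa using hc)
  have hmajorant := (hα.norm.mul_of_nonneg (summable_geometric_of_lt_one (norm_nonneg x) hx)
    (fun _ => norm_nonneg _) fun _ => by positivity).mul_left (K₁ * K₂ * K₃)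
  refine .of_norm_bounded hmajorant fun ⟨r, k⟩ => ?_
  calc ‖qPochs [u, v] q (r + k) * x ^ (r + k)
        * (α r / (qPoch q q k * qPoch (c * q) q (2 * r + k)))‖
      = ‖qPochs [u, v] q (r + k)‖ * ‖(qPochs [q] q k)⁻¹‖ * ‖(qPochs [c * q] q (2 * r + k))⁻¹‖
        * (‖α r * x ^ r‖ * ‖x‖ ^ k) := by
        simp only [qPochs_cons, qPochs_nil, mul_one, norm_mul, norm_div, norm_inv, norm_pow]
        ring
    _ ≤ K₁ * K₂ * K₃ * (‖α r * x ^ r‖ * ‖x‖ ^ k) := by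
        gcongr
        exacts [huv (r + k), hqinv k, hcinv (2 * r + k)]

theorem hasSum_sum_antidiagonal {R : Type*} [AddCommGroup R] [UniformSpace R]
    [IsUniformAddGroup R] [CompleteSpace R] [T0Space R] {f : ℕ × ℕ → R} (hf : Summable f) :
    HasSum (fun n => ∑ p ∈ antidiagonal n, f p) (∑' r, ∑' k, f (r, k)) := by
  rw [← hf.tsum_prod]
  refine (HasAntidiagonal.sigmaAntidiagonalEquivProd.hasSum_iff.2 hf.hasSum).sigma fun n => ?_
  rw [← sum_coe_sort]
  exact hasSum_fintype _

theorem IsBaileyPair.hasSum (h : IsBaileyPair q c α β) (hq : ‖q‖ < 1) (hx : ‖x‖ < 1)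
    (hc : ∀ k : ℕ, c * q * q ^ k ≠ 1) (hα : Summable fun r => α r * x ^ r) :
    HasSum (fun n => qPochs [u, v] q n * x ^ n * β n)
      (∑' r, ∑' k, qPochs [u, v] q (r + k) * x ^ (r + k)
        * (α r / (qPoch q q k * qPoch (c * q) q (2 * r + k)))) := by
  refine (hasSum_sum_antidiagonal (summable_bailey_double u v hq hx hc hα)).congr_fun fun n => ?_
  rw [h n, mul_sum]
  exact sum_congr rfl fun p hp => by rw [mem_antidiagonal.1 hp]

/-- The `q`-Gauss sum evaluates `γ_r = ∑_{n ≥ r} δ_n / ((q; q)_{n-r} (cq; q)_{n+r})` for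
`δ_n = (u, v; q)_n x ^ n`, that is, it makes `(δ, γ)` a conjugate Bailey pair. -/
theorem tsum_conjugate_baileyPair (hq : ‖q‖ < 1) (hx : ‖x‖ < 1)
    (hc : ∀ k : ℕ, c * q * q ^ k ≠ 1) (huvx : u * v * x = c * q)
    (hu : ∀ k : ℕ, u * x * q ^ k ≠ 1) (hv : ∀ k : ℕ, v * x * q ^ k ≠ 1) (r : ℕ) :
    qPochsInf [c * q, x] q * ∑' k, qPochs [u, v] q (r + k) * x ^ (r + k)
        / (qPoch q q k * qPoch (c * q) q (2 * r + k))
      = qPochsInf [v * x, u * x] q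
        * (qPochs [u, v] q r / qPochs [v * x, u * x] q r * x ^ r) := by
  have hbase : u * q ^ r * (v * q ^ r) * x = c * q * q ^ (2 * r) := by
    rw [two_mul, pow_add, ← huvx]; ring
  have hterm (k : ℕ) : qPochs [u, v] q (r + k) * x ^ (r + k)
        / (qPoch q q k * qPoch (c * q) q (2 * r + k))
      = qPochs [u, v] q r * x ^ r / qPoch (c * q) q (2 * r)
        * phiTerm q (u * q ^ r) (v * q ^ r) (u * q ^ r * (v * q ^ r) * x) x k := by
    rw [hbase, phiTerm, qPochs_add, qPoch_add _ _ (2 * r), pow_add]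
    simp only [List.map_cons, List.map_nil, qPochs_cons, qPochs_nil]
    ring
  have hgauss := tsum_phiTerm_gauss (u * q ^ r) (v * q ^ r) hq hx fun k => by
    rw [hbase, mul_assoc _ (q ^ _), ← pow_add]; exact hc _
  have hdenom : qPochs [v * x, u * x] q r ≠ 0 := qPochs_ne_zero (by simpa using ⟨hv, hu⟩) r
  have hc2r : qPoch (c * q) q (2 * r) ≠ 0 := qPoch_ne_zero hc _
  have hlhs : qPochsInf [c * q, x] q
      = qPoch (c * q) q (2 * r) * qPochsInf [u * q ^ r * (v * q ^ r) * x, x] q := by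
    rw [hbase, qPochsInf_cons, qPochInf_eq_qPoch_mul _ hq (2 * r), qPochsInf_cons (_ * _),
      mul_assoc]
  have hrhs : qPochsInf [v * x, u * x] q
      = qPochs [v * x, u * x] q r * qPochsInf [v * q ^ r * x, u * q ^ r * x] q := by
    rw [qPochsInf_eq_qPochs_mul _ hq r]
    simp only [List.map_cons, List.map_nil, mul_right_comm]
  rw [tsum_congr hterm, tsum_mul_left, hlhs, hrhs, ← hgauss]
  field_simp

theorem summable_bailey_alpha (hq : ‖q‖ < 1) (hu : ∀ k : ℕ, u * x * q ^ k ≠ 1)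
    (hv : ∀ k : ℕ, v * x * q ^ k ≠ 1) (hα : Summable fun r => α r * x ^ r) :
    Summable fun r => qPochs [u, v] q r / qPochs [v * x, u * x] q r * x ^ r * α r := by
  obtain ⟨K₁, hK₁, huv⟩ := exists_norm_qPochs_le [u, v] hq
  obtain ⟨K₂, -, hinv⟩ := exists_norm_inv_qPochs_le (l := [v * x, u * x]) hq
    (by simpa using ⟨hv, hu⟩)
  refine .of_norm_bounded (hα.norm.mul_left (K₁ * K₂)) fun r => ?_
  rw [div_eq_mul_inv, mul_assoc _ (x ^ r), mul_comm (x ^ r), norm_mul, norm_mul]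
  gcongr
  exacts [huv r, hinv r]

theorem IsBaileyPair.bailey_lemma (h : IsBaileyPair q c α β) (hq : ‖q‖ < 1) (hx : ‖x‖ < 1)
    (hc : ∀ k : ℕ, c * q * q ^ k ≠ 1) (huvx : u * v * x = c * q)
    (hu : ∀ k : ℕ, u * x * q ^ k ≠ 1) (hv : ∀ k : ℕ, v * x * q ^ k ≠ 1)
    (hα : Summable fun r => α r * x ^ r) :
    qPochsInf [c * q, x] q * ∑' n, qPochs [u, v] q n * x ^ n * β n
      = qPochsInf [v * x, u * x] q
        * ∑' r, qPochs [u, v] q r / qPochs [v * x, u * x] q r * x ^ r * α r := by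
  rw [(h.hasSum u v hq hx hc hα).tsum_eq, ← tsum_mul_left, ← tsum_mul_left]
  refine tsum_congr fun r => ?_
  have hγ := tsum_conjugate_baileyPair u v hq hx hc huvx hu hv r
  calc qPochsInf [c * q, x] q * ∑' k, qPochs [u, v] q (r + k) * x ^ (r + k)
        * (α r / (qPoch q q k * qPoch (c * q) q (2 * r + k)))
      = qPochsInf [c * q, x] q * (∑' k, qPochs [u, v] q (r + k) * x ^ (r + k)
        / (qPoch q q k * qPoch (c * q) q (2 * r + k))) * α r := by
        rw [mul_assoc, ← tsum_mul_right]
        exact congrArg _ (tsum_congr fun k => by ring)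
    _ = qPochsInf [v * x, u * x] q
        * (qPochs [u, v] q r / qPochs [v * x, u * x] q r * x ^ r * α r) := by
        rw [hγ, mul_assoc]

end BaileyLemma

/-- The term of index `r` of the theta series `∑ (-1)^r q^(r(r-1)/2) z^r` over `ℤ` in Jacobi's
triple product identity; the integer division by `2` is exact. -/
noncomputable def thetaTerm (q z : ℂ) (r : ℤ) : ℂ := (-1) ^ r * q ^ (r * (r - 1) / 2) * z ^ r

theorem natCast_mul_sub_one_ediv_two (r : ℕ) : (r : ℤ) * (r - 1) / 2 = r.choose 2 := by
  cases r with
  | zero => simp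
  | succ r => simp [Nat.choose_two_right]

theorem thetaTerm_natCast (q z : ℂ) (r : ℕ) :
    thetaTerm q z r = (-1) ^ r * q ^ r.choose 2 * z ^ r := by
  simp only [thetaTerm, natCast_mul_sub_one_ediv_two, zpow_natCast]

theorem thetaTerm_neg {q : ℂ} (hq0 : q ≠ 0) (z : ℂ) (r : ℤ) :
    thetaTerm q z (-r) = q ^ r * thetaTerm q z⁻¹ r := by
  have hexp : -r * (-r - 1) / 2 = r * (r - 1) / 2 + r := by
    rw [← Int.add_mul_ediv_right _ _ two_ne_zero]; ring_nf
  rw [thetaTerm, thetaTerm, hexp, zpow_add₀ hq0, zpow_neg, ← inv_zpow, zpow_neg, ← inv_zpow,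
    inv_neg_one]
  ring

theorem thetaTerm_add_one {q z : ℂ} (hq0 : q ≠ 0) (hz : z ≠ 0) (r : ℤ) :
    thetaTerm q z (r + 1) = -z * thetaTerm q (z * q) r := by
  have hexp : (r + 1) * (r + 1 - 1) / 2 = r * (r - 1) / 2 + r := by
    rw [← Int.add_mul_ediv_right _ _ two_ne_zero]; ring_nf
  rw [thetaTerm, thetaTerm, hexp, zpow_add₀ hq0, zpow_add_one₀ hz, mul_zpow,
    zpow_add_one₀ (neg_ne_zero.2 one_ne_zero)]
  ring

theorem thetaTerm_sub_one {q z : ℂ} (hq0 : q ≠ 0) (hz : z ≠ 0) (r : ℤ) :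
    thetaTerm q z (r - 1) = -(q / z) * thetaTerm q (z / q) r := by
  have hstep := thetaTerm_add_one hq0 (div_ne_zero hz hq0) (r - 1)
  rw [sub_add_cancel, div_mul_cancel₀ z hq0] at hstep
  rw [hstep]
  field_simp

theorem one_sub_pow_succ_mul_sum_antidiagonal {q : ℂ} (hqq : ∀ k : ℕ, q * q ^ k ≠ 1) (t : ℕ → ℂ)
    (n : ℕ) :
    (1 - q ^ (n + 1)) * ∑ p ∈ antidiagonal (n + 1), t p.1 / (qPoch q q p.1 * qPoch q q p.2)
      = ∑ p ∈ antidiagonal n,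
          (t (p.1 + 1) + q ^ p.1 * t p.1) / (qPoch q q p.1 * qPoch q q p.2) := by
  have hcancel (m : ℕ) (x y : ℂ) :
      (1 - q ^ (m + 1)) * x / (qPoch q q (m + 1) * y) = x / (qPoch q q m * y) := by
    rw [qPoch_succ, ← pow_succ', mul_comm (qPoch q q m), mul_assoc, mul_div_mul_left _ _
      (sub_ne_zero.2 (pow_succ' q m ▸ hqq m).symm)]
  have hsplit (p : ℕ × ℕ) (hp : p ∈ antidiagonal (n + 1)) :
      (1 - q ^ (n + 1)) * (t p.1 / (qPoch q q p.1 * qPoch q q p.2))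
        = (1 - q ^ p.1) * t p.1 / (qPoch q q p.1 * qPoch q q p.2)
          + (1 - q ^ p.2) * (q ^ p.1 * t p.1) / (qPoch q q p.2 * qPoch q q p.1) := by
    rw [← mem_antidiagonal.1 hp, pow_add]
    ring
  rw [mul_sum, sum_congr rfl hsplit, sum_add_distrib, Nat.sum_antidiagonal_succ,
    Nat.sum_antidiagonal_succ']
  simp only [pow_zero, sub_self, zero_mul, zero_div, zero_add, hcancel, ← sum_add_distrib]
  refine sum_congr rfl fun p _ => ?_
  rw [mul_comm (qPoch q q p.2), ← add_div]

theorem sum_antidiagonal_q_binomial {q : ℂ} (hqq : ∀ k : ℕ, q * q ^ k ≠ 1) (n : ℕ) (z : ℂ) :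
    ∑ p ∈ antidiagonal n,
        (-1) ^ p.1 * q ^ p.1.choose 2 * z ^ p.1 / (qPoch q q p.1 * qPoch q q p.2)
      = qPoch z q n / qPoch q q n := by
  induction n generalizing z with
  | zero => simp [qPoch_zero]
  | succ n ih =>
    have hne : 1 - q ^ (n + 1) ≠ 0 := sub_ne_zero.2 (pow_succ' q n ▸ hqq n).symm
    have hshift (r : ℕ) : (-1) ^ (r + 1) * q ^ (r + 1).choose 2 * z ^ (r + 1)
        + q ^ r * ((-1) ^ r * q ^ r.choose 2 * z ^ r)
          = (1 - z) * ((-1) ^ r * q ^ r.choose 2 * (z * q) ^ r) := by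
      rw [Nat.choose_succ_succ' r 1, Nat.choose_one_right, pow_add q, mul_pow]
      ring
    refine mul_left_cancel₀ hne ?_
    rw [one_sub_pow_succ_mul_sum_antidiagonal hqq fun r => (-1) ^ r * q ^ r.choose 2 * z ^ r]
    simp only [hshift, mul_div_assoc (1 - z), ← mul_sum]
    rw [ih, qPoch_succ', qPoch_succ, ← pow_succ', mul_comm (qPoch q q n), ← mul_div_assoc,
      ← mul_div_assoc, mul_div_mul_left _ _ hne]

/-- Replacing `z` by `z / q` carries the case `(m + 1, n)` to `(m, n + 1)`, so that induction on `n`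
starts from the `q`-binomial theorem. -/
theorem finite_jacobi_triple_product {q z : ℂ} (hq0 : q ≠ 0) (hqq : ∀ k : ℕ, q * q ^ k ≠ 1)
    (hz : z ≠ 0) (m n : ℕ) :
    ∑ p ∈ antidiagonal (m + n), thetaTerm q z (p.1 - n) / (qPoch q q p.1 * qPoch q q p.2)
      = qPoch z q m * qPoch (q / z) q n / qPoch q q (m + n) := by
  induction n generalizing m z with
  | zero => simpa [qPoch_zero, thetaTerm_natCast] using sum_antidiagonal_q_binomial hqq m z
  | succ n ih =>
    have hz1 : qPoch (z / q) q (m + 1) = (1 - z / q) * qPoch z q m := by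
      rw [qPoch_succ', div_mul_cancel₀ _ hq0]
    have hz2 : qPoch (q / z) q (n + 1) = (1 - q / z) * qPoch (q / (z / q)) q n := by
      rw [qPoch_succ', div_div_eq_mul_div, mul_div_right_comm]
    have hflip : 1 - q / z = -(q / z) * (1 - z / q) := by field_simp; ring
    calc ∑ p ∈ antidiagonal (m + (n + 1)),
          thetaTerm q z (p.1 - (n + 1 : ℕ)) / (qPoch q q p.1 * qPoch q q p.2)
        = -(q / z) * ∑ p ∈ antidiagonal (m + 1 + n),
          thetaTerm q (z / q) (p.1 - n) / (qPoch q q p.1 * qPoch q q p.2) := by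
          rw [mul_sum, add_right_comm, add_assoc]
          refine sum_congr rfl fun p _ => ?_
          rw [Nat.cast_add_one, ← sub_sub, thetaTerm_sub_one hq0 hz, mul_div_assoc]
      _ = qPoch z q m * qPoch (q / z) q (n + 1) / qPoch q q (m + (n + 1)) := by
          rw [ih (div_ne_zero hz hq0), hz1, hz2, hflip, add_right_comm, add_assoc]
          ring

theorem sum_antidiagonal_two_mul {M : Type*} [AddCommMonoid M] (f : ℕ × ℕ → M) (n : ℕ) :
    ∑ p ∈ antidiagonal (2 * n), f p = ∑ p ∈ antidiagonal n,
      if p.1 = 0 then f (p.2, p.2) else f (2 * p.1 + p.2, p.2) + f (p.2, 2 * p.1 + p.2) := by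
  induction n generalizing f with
  | zero => simp
  | succ n ih =>
    rw [mul_add_one, Nat.sum_antidiagonal_succ, Nat.sum_antidiagonal_succ',
      ih fun p => f (p.1 + 1, p.2 + 1), Nat.sum_antidiagonal_succ', ← add_assoc, add_comm]
    simp [two_mul, add_assoc, add_comm, add_left_comm]

theorem isBaileyPair_thetaTerm {q z : ℂ} (hq0 : q ≠ 0) (hqq : ∀ k : ℕ, q * q ^ k ≠ 1)
    (hz : z ≠ 0) :
    IsBaileyPair q 1 (fun r => if r = 0 then 1 else thetaTerm q z r + thetaTerm q z (-r))
      fun n => qPoch z q n * qPoch (q / z) q n / qPoch q q (2 * n) := by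
  intro n
  have hjacobi := finite_jacobi_triple_product hq0 hqq hz n n
  rw [← two_mul, sum_antidiagonal_two_mul] at hjacobi
  refine hjacobi.symm.trans (sum_congr rfl fun p hp => ?_)
  have hn : (n : ℤ) = p.1 + p.2 := by rw [← mem_antidiagonal.1 hp, Nat.cast_add]
  have hfst : ((2 * p.1 + p.2 : ℕ) : ℤ) - n = p.1 := by rw [hn]; push_cast; ring
  have hsnd : (p.2 : ℤ) - n = -p.1 := by rw [hn]; ring
  rcases eq_or_ne p.1 0 with hp0 | hp0
  · simp [hsnd, hp0, thetaTerm]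
  · simp only [if_neg hp0, hfst, hsnd, one_mul, add_div, mul_comm (qPoch q q p.2)]

theorem qPoch_mul_add_qPoch_mul (q : ℂ) {z : ℂ} (hz : z ≠ 0) (n : ℕ) :
    qPoch z q n * qPoch (q / z) q n + qPoch z⁻¹ q n * qPoch (q / z⁻¹) q n
      = (1 + q ^ n) * qPochs [z, z⁻¹] q n := by
  simp only [qPochs_cons, qPochs_nil, mul_one]
  cases n with
  | zero => norm_num [qPoch_zero]
  | succ n =>
    rw [qPoch_succ' z, qPoch_succ' z⁻¹, qPoch_succ (q / z), qPoch_succ (q / z⁻¹), div_inv_eq_mul,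
      inv_mul_eq_div, mul_comm z q, pow_succ]
    field_simp
    ring

theorem one_add_pow_mul_qPochs {q s : ℂ} (hs : s ^ 2 = q) (n : ℕ) :
    (1 + q ^ n) * qPochs [q, -1, s, -s] q n = 2 * qPoch q q (2 * n) := by
  simp only [qPochs_cons, qPochs_nil, mul_one]
  induction n with
  | zero => norm_num [qPoch_zero]
  | succ n ih =>
    have hodd : (1 - s * q ^ n) * (1 + s * q ^ n) = 1 - q * q ^ (2 * n) := by
      rw [two_mul, pow_add]; linear_combination -(q ^ n * q ^ n) * hs
    have heven : (1 - q * q ^ n) * (1 + q ^ (n + 1)) = 1 - q * q ^ (2 * n + 1) := by ring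
    rw [mul_add_one, qPoch_succ q q (2 * n + 1), qPoch_succ q q (2 * n), ← hodd, ← heven]
    simp only [qPoch_succ]
    linear_combination (1 - s * q ^ n) * (1 + s * q ^ n) * (1 - q * q ^ n) * (1 + q ^ (n + 1)) * ih

/-- The sequence `α` of the Bailey pair relative to `1` that is obtained by averaging the finite
form of Jacobi's triple product identity over `z ↔ z⁻¹`. -/
noncomputable def jacobiAlpha (q z : ℂ) (r : ℕ) : ℂ :=
  if r = 0 then 1 else (-1) ^ r * q ^ r.choose 2 * (1 + q ^ r) * ((z ^ r + z⁻¹ ^ r) / 2)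

theorem isBaileyPair_jacobiAlpha {q s z : ℂ} (hq0 : q ≠ 0) (hqq : ∀ k : ℕ, q * q ^ k ≠ 1)
    (hs : s ^ 2 = q) (hz : z ≠ 0) :
    IsBaileyPair q 1 (jacobiAlpha q z)
      fun n => qPochs [z, z⁻¹] q n / qPochs [q, -1, s, -s] q n := by
  convert ((isBaileyPair_thetaTerm hq0 hqq hz).add
    (isBaileyPair_thetaTerm hq0 hqq (inv_ne_zero hz))).const_smul (1 / 2) using 1
  · funext r
    simp only [Pi.smul_apply, Pi.add_apply, smul_eq_mul, jacobiAlpha]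
    split_ifs
    · norm_num
    · rw [thetaTerm_neg hq0, thetaTerm_neg hq0, inv_inv, thetaTerm_natCast, thetaTerm_natCast,
        zpow_natCast]
      ring
  · funext n
    have hdouble := one_add_pow_mul_qPochs hs n
    have hpoch : qPoch q q (2 * n) ≠ 0 := qPoch_ne_zero hqq _
    have hdenom : (1 + q ^ n) * qPochs [q, -1, s, -s] q n ≠ 0 :=
      hdouble ▸ mul_ne_zero two_ne_zero hpoch
    simp only [Pi.smul_apply, Pi.add_apply, smul_eq_mul]
    rw [← add_div, qPoch_mul_add_qPoch_mul q hz, div_mul_div_comm, one_mul, ← hdouble,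
      mul_div_mul_left _ _ (left_ne_zero_of_mul hdenom)]

theorem summable_pow_choose_two_mul_pow {q : ℂ} (hq : ‖q‖ < 1) (w : ℂ) :
    Summable fun r : ℕ => q ^ r.choose 2 * w ^ r := by
  have hratio : Tendsto (fun r : ℕ => ‖q ^ r * w‖) atTop (𝓝 0) := by
    simpa using ((tendsto_pow_atTop_nhds_zero_of_norm_lt_one hq).mul_const w).norm
  refine summable_of_ratio_norm_eventually_le one_half_lt_one ?_
  filter_upwards [hratio.eventually_le_const one_half_pos] with r hr
  have hsucc : q ^ (r + 1).choose 2 * w ^ (r + 1) = q ^ r * w * (q ^ r.choose 2 * w ^ r) := by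
    rw [Nat.choose_succ_succ' r 1, Nat.choose_one_right, pow_add, pow_succ]
    ring
  rw [hsucc, norm_mul]
  gcongr

theorem summable_jacobiAlpha_mul_pow {q : ℂ} (hq : ‖q‖ < 1) (z x : ℂ) :
    Summable fun r => jacobiAlpha q z r * x ^ r := by
  have htheta := summable_pow_choose_two_mul_pow hq
  refine (((htheta (-(z * x))).add (htheta (-(z * x * q)))).add
    ((htheta (-(z⁻¹ * x))).add (htheta (-(z⁻¹ * x * q))))).div_const 2 |>.congr_atTop ?_
  filter_upwards [eventually_ne_atTop 0] with r hr
  rw [jacobiAlpha, if_neg hr]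
  simp only [neg_pow (_ * _), mul_pow]
  ring

/-- The `m`-th term of the right-hand side of Bailey's lemma for the pair of `jacobiAlpha`, with the
parameters `q / a`, `q / b` and `x = ab / q`. -/
noncomputable def jacobiTerm (q a b z : ℂ) (m : ℕ) : ℂ :=
  qPochs [q / a, q / b] q m / qPochs [a, b] q m * (a * b / q) ^ m * jacobiAlpha q z m

theorem qPochs_cons_cons_div_mul (u v : ℂ) (l : List ℂ) (q d y : ℂ) (n : ℕ) :
    qPochs (u :: v :: l) q n / d * y = qPochs [u, v] q n * y * (qPochs l q n / d) := by
  simp only [qPochs_cons, qPochs_nil]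
  ring

section JacobiSeries

variable {q s a b z : ℂ}

theorem summable_jacobiTerm (hq0 : q ≠ 0) (hq : ‖q‖ < 1) (ha0 : a ≠ 0) (hb0 : b ≠ 0)
    (ha : ∀ k : ℕ, a * q ^ k ≠ 1) (hb : ∀ k : ℕ, b * q ^ k ≠ 1) :
    Summable (jacobiTerm q a b z) := by
  have hux : q / a * (a * b / q) = b := by field_simp
  have hvx : q / b * (a * b / q) = a := by field_simp
  have hsum := summable_bailey_alpha (q / a) (q / b) hq (by rwa [hux]) (by rwa [hvx])
    (summable_jacobiAlpha_mul_pow hq z (a * b / q))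
  rwa [hux, hvx] at hsum

theorem summable_jacobi_series (hq0 : q ≠ 0) (hq : ‖q‖ < 1) (hs : s ^ 2 = q) (hz : z ≠ 0)
    (hx : ‖a * b / q‖ < 1) :
    Summable fun n => qPochs [q / a, q / b, z, z⁻¹] q n / qPochs [q, -1, s, -s] q n
      * (a * b / q) ^ n := by
  have hqq := mul_pow_ne_one_of_norm_lt_one hq hq.le
  simp only [qPochs_cons_cons_div_mul]
  exact ((isBaileyPair_jacobiAlpha hq0 hqq hs hz).hasSum (q / a) (q / b) hq hx
    (by rwa [one_mul]) (summable_jacobiAlpha_mul_pow hq z _)).summable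

theorem tsum_jacobi_series (hq0 : q ≠ 0) (hq : ‖q‖ < 1) (hs : s ^ 2 = q) (hz : z ≠ 0)
    (ha0 : a ≠ 0) (hb0 : b ≠ 0) (ha : ∀ k : ℕ, a * q ^ k ≠ 1) (hb : ∀ k : ℕ, b * q ^ k ≠ 1)
    (hx : ‖a * b / q‖ < 1) :
    qPochsInf [q, a * b / q] q / qPochsInf [a, b] q
        * ∑' n, qPochs [q / a, q / b, z, z⁻¹] q n / qPochs [q, -1, s, -s] q n * (a * b / q) ^ n
      = ∑' m, jacobiTerm q a b z m := by
  have hqq := mul_pow_ne_one_of_norm_lt_one hq hq.le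
  have hux : q / a * (a * b / q) = b := by field_simp
  have hvx : q / b * (a * b / q) = a := by field_simp
  have huvx : q / a * (q / b) * (a * b / q) = 1 * q := by field_simp
  have hab : qPochsInf [a, b] q ≠ 0 := qPochsInf_ne_zero hq (by simpa using ⟨ha, hb⟩)
  have hbailey := (isBaileyPair_jacobiAlpha hq0 hqq hs hz).bailey_lemma (q / a) (q / b) hq hx
    (by rwa [one_mul]) huvx (by rwa [hux]) (by rwa [hvx]) (summable_jacobiAlpha_mul_pow hq z _)
  rw [hux, hvx, one_mul] at hbailey
  simp only [qPochs_cons_cons_div_mul]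
  rw [div_mul_eq_mul_div, hbailey, mul_div_cancel_left₀ _ hab]
  rfl

end JacobiSeries

theorem jacobiTerm_zero (q a b z : ℂ) : jacobiTerm q a b z 0 = 1 := by
  simp [jacobiTerm, jacobiAlpha, qPochs_zero]

theorem jacobiTerm_of_ne_zero {q : ℂ} (hq0 : q ≠ 0) (a b z : ℂ) {m : ℕ} (hm : m ≠ 0) :
    jacobiTerm q a b z m = (-1) ^ m * ((z ^ m + z⁻¹ ^ m) / 2) * rhsFactor q a b m
      * q ^ (((m : ℤ) ^ 2 - 3 * m) / 2) := by
  have hexp : ((m : ℤ) ^ 2 - 3 * m) / 2 = m.choose 2 - m := by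
    rw [← natCast_mul_sub_one_ediv_two, eq_sub_iff_add_eq, ← Int.add_mul_ediv_right _ _ two_ne_zero]
    ring_nf
  rw [hexp, zpow_sub₀ hq0, zpow_natCast, zpow_natCast, jacobiTerm, jacobiAlpha, if_neg hm,
    rhsFactor, div_pow, mul_pow]
  ring

theorem add_inv_eq_neg_one_of_isPrimitiveRoot_three {K : Type*} [Field K] {ζ : K}
    (hζ : IsPrimitiveRoot ζ 3) : ζ + ζ⁻¹ = -1 := by
  have hinv : ζ⁻¹ = ζ ^ 2 := inv_eq_of_mul_eq_one_right (by rw [← pow_succ', hζ.pow_eq_one])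
  have hgeom := hζ.geom_sum_eq_zero (by norm_num)
  simp only [sum_range_succ, sum_range_zero] at hgeom
  rw [hinv]
  linear_combination hgeom

section CubeRoot

variable {q ω : ℂ} (hq0 : q ≠ 0) (hω : IsPrimitiveRoot ω 3) (a b : ℂ)
include hq0 hω

theorem jacobiTerm_of_coprime {m : ℕ} (hm : m.Coprime 3) :
    jacobiTerm q a b ω m
      = (-1) ^ (m + 1) / 2 * rhsFactor q a b m * q ^ (((m : ℤ) ^ 2 - 3 * m) / 2) := by
  have hm0 : m ≠ 0 := by rintro rfl; norm_num at hm
  rw [jacobiTerm_of_ne_zero hq0 a b ω hm0, inv_pow,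
    add_inv_eq_neg_one_of_isPrimitiveRoot_three (hω.pow_of_coprime m hm)]
  ring

theorem jacobiTerm_three_mul {n : ℕ} (hn : n ≠ 0) :
    jacobiTerm q a b ω (3 * n)
      = (-1) ^ n * rhsFactor q a b (3 * n) * q ^ ((9 * (n : ℤ) ^ 2 - 9 * n) / 2) := by
  have hexp : ((3 * n : ℕ) : ℤ) ^ 2 - 3 * (3 * n : ℕ) = 9 * (n : ℤ) ^ 2 - 9 * n := by
    push_cast; ring
  have hsign : (-1 : ℂ) ^ (3 * n) = (-1) ^ n := by rw [pow_mul]; norm_num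
  rw [jacobiTerm_of_ne_zero hq0 a b ω (by positivity), hexp, hsign, inv_pow, pow_mul,
    hω.pow_eq_one]
  norm_num

theorem jacobiTerm_three_mul_sub_one {n : ℕ} (hn : n ≠ 0) :
    jacobiTerm q a b ω (3 * n - 1) = q ^ 2 / 2
      * ((-1) ^ n * rhsFactor q a b (3 * n - 1) * q ^ ((9 * (n : ℤ) ^ 2 - 15 * n) / 2)) := by
  have hcast : ((3 * n - 1 : ℕ) : ℤ) = 3 * n - 1 := by omega
  have hexp : ((3 * n - 1 : ℤ) ^ 2 - 3 * (3 * n - 1)) / 2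
      = (9 * (n : ℤ) ^ 2 - 15 * n) / 2 + 2 := by
    rw [← Int.add_mul_ediv_right _ _ two_ne_zero]; ring_nf
  have hsign : (-1 : ℂ) ^ (3 * n - 1 + 1) = (-1) ^ n := by
    rw [Nat.sub_add_cancel (by omega), pow_mul]; norm_num
  have hcoprime : (3 * n - 1).Coprime 3 := by
    rw [Nat.coprime_comm, Nat.prime_three.coprime_iff_not_dvd]; omega
  rw [jacobiTerm_of_coprime hq0 hω a b hcoprime, hcast, hexp, hsign, zpow_add₀ hq0, zpow_ofNat]
  ring

theorem jacobiTerm_three_mul_add_one (n : ℕ) :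
    jacobiTerm q a b ω (3 * n + 1) = 1 / (2 * q)
      * ((-1) ^ n * rhsFactor q a b (3 * n + 1) * q ^ ((9 * (n : ℤ) ^ 2 - 3 * n) / 2)) := by
  have hexp : (((3 * n + 1 : ℕ) : ℤ) ^ 2 - 3 * (3 * n + 1 : ℕ)) / 2
      = (9 * (n : ℤ) ^ 2 - 3 * n) / 2 + -1 := by
    rw [← Int.add_mul_ediv_right _ _ two_ne_zero]; push_cast; ring_nf
  have hsign : (-1 : ℂ) ^ (3 * n + 1 + 1) = (-1) ^ n := by
    rw [add_assoc, pow_add, pow_mul]; norm_num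
  have hcoprime : (3 * n + 1).Coprime 3 := by
    rw [Nat.coprime_comm, Nat.prime_three.coprime_iff_not_dvd]; omega
  rw [jacobiTerm_of_coprime hq0 hω a b hcoprime, hexp, hsign, zpow_add₀ hq0, zpow_neg_one, one_div,
    mul_inv]
  ring

end CubeRoot

theorem tsum_split_mod_three {R : Type*} [AddCommGroup R] [UniformSpace R] [IsUniformAddGroup R]
    [CompleteSpace R] [T0Space R] {f : ℕ → R} (hf : Summable f) :
    ∑' n, f n = f 0 + ∑' n : ℕ+, f (3 * n) + ∑' n : ℕ+, f (3 * n - 1) + ∑' n, f (3 * n + 1) := by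
  have hzero : Summable fun n => f (3 * n) := hf.comp_injective fun _ _ h => by simpa using h
  have hshift (n : ℕ) : 3 * (n + 1) - 1 = 2 + 3 * n := by omega
  calc ∑' n, f n = ∑ j : Fin 3, ∑' m, f (ZMod.val (n := 3) j + 3 * m) :=
        Nat.sumByResidueClasses hf 3
    _ = ∑' m, f (0 + 3 * m) + ∑' m, f (1 + 3 * m) + ∑' m, f (2 + 3 * m) := Fin.sum_univ_three _
    _ = _ := by
        rw [tsum_pnat_eq_tsum_succ (f := fun n => f (3 * n)),
          tsum_pnat_eq_tsum_succ (f := fun n => f (3 * n - 1))]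
        simp only [zero_add, hshift, add_comm 1]
        rw [hzero.tsum_eq_zero_add, mul_zero, add_right_comm]

theorem mainTheorem11_general (q s a b ω : ℂ)
    (hq0 : q ≠ 0) (hq : ‖q‖ < 1) (hs : s ^ 2 = q)
    (ha0 : a ≠ 0) (hb0 : b ≠ 0)
    (ha : ∀ k : ℕ, a * q ^ k ≠ 1) (hb : ∀ k : ℕ, b * q ^ k ≠ 1)
    (hx : ‖a * b / q‖ < 1) (hω : IsPrimitiveRoot ω 3) :
    Summable (lhsTerm q s a b ω) ∧
    Summable (fun n : ℕ+ => (-1 : ℂ) ^ (n : ℕ) * rhsFactor q a b (3 * (n : ℕ))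
      * q ^ ((9 * (n : ℤ) ^ 2 - 9 * (n : ℤ)) / 2)) ∧
    Summable (fun n : ℕ+ => (-1 : ℂ) ^ (n : ℕ) * rhsFactor q a b (3 * (n : ℕ) - 1)
      * q ^ ((9 * (n : ℤ) ^ 2 - 15 * (n : ℤ)) / 2)) ∧
    Summable (fun n : ℕ => (-1 : ℂ) ^ n * rhsFactor q a b (3 * n + 1)
      * q ^ ((9 * (n : ℤ) ^ 2 - 3 * (n : ℤ)) / 2)) ∧
    qPochsInf [q, a * b / q] q / qPochsInf [a, b] q * ∑' n : ℕ, lhsTerm q s a b ω n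
      = 1
        + ∑' n : ℕ+, (-1 : ℂ) ^ (n : ℕ) * rhsFactor q a b (3 * (n : ℕ))
            * q ^ ((9 * (n : ℤ) ^ 2 - 9 * (n : ℤ)) / 2)
        + q ^ 2 / 2 * ∑' n : ℕ+, (-1 : ℂ) ^ (n : ℕ) * rhsFactor q a b (3 * (n : ℕ) - 1)
            * q ^ ((9 * (n : ℤ) ^ 2 - 15 * (n : ℤ)) / 2)
        + 1 / (2 * q) * ∑' n : ℕ, (-1 : ℂ) ^ n * rhsFactor q a b (3 * n + 1)
            * q ^ ((9 * (n : ℤ) ^ 2 - 3 * (n : ℤ)) / 2) := by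
  have hω0 : ω ≠ 0 := hω.ne_zero three_ne_zero
  have hinv : ω ^ 2 = ω⁻¹ :=
    (inv_eq_of_mul_eq_one_right (by rw [← pow_succ', hω.pow_eq_one])).symm
  have hsum : Summable (jacobiTerm q a b ω) := summable_jacobiTerm hq0 hq ha0 hb0 ha hb
  have hzero (n : ℕ+) := jacobiTerm_three_mul hq0 hω a b n.ne_zero
  have htwo (n : ℕ+) := jacobiTerm_three_mul_sub_one hq0 hω a b n.ne_zero
  have hone := jacobiTerm_three_mul_add_one hq0 hω a b
  have hzero_inj : (fun n : ℕ+ => 3 * (n : ℕ)).Injective := fun m n h => by simpa using h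
  have htwo_inj : (fun n : ℕ+ => 3 * (n : ℕ) - 1).Injective := fun m n h =>
    PNat.eq (by have := m.pos; have := n.pos; dsimp only at h; omega)
  have hone_inj : (fun n : ℕ => 3 * n + 1).Injective := fun m n h => by simpa using h
  unfold lhsTerm
  rw [hinv]
  refine ⟨summable_jacobi_series hq0 hq hs hω0 hx, (hsum.comp_injective hzero_inj).congr hzero,
    (summable_mul_left_iff (by simpa using hq0)).1 ((hsum.comp_injective htwo_inj).congr htwo),
    (summable_mul_left_iff (by simpa using hq0)).1 ((hsum.comp_injective hone_inj).congr hone), ?_⟩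
  rw [tsum_jacobi_series hq0 hq hs hω0 ha0 hb0 ha hb hx, tsum_split_mod_three hsum,
    jacobiTerm_zero, tsum_congr hzero, tsum_congr htwo, tsum_congr hone, tsum_mul_left,
    tsum_mul_left]

/-- In the exponents of `q` below, the integer division by `2` is exact, and the exponents
may be negative. Sums over `ℕ+` are the sums starting at `n = 1`. -/
theorem mainTheorem11 (q s a b ω : ℂ)
    (hq0 : q ≠ 0) (hq : ‖q‖ < 1) (hs : s ^ 2 = q)
    (ha0 : a ≠ 0) (hb0 : b ≠ 0)
    (hab : max (max ‖a‖ ‖b‖) ‖a * b / q‖ < 1)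
    (hω : ω = Complex.exp (2 * Real.pi * Complex.I / 3)) :
    Summable (lhsTerm q s a b ω) ∧
    Summable (fun n : ℕ+ => (-1 : ℂ) ^ (n : ℕ) * rhsFactor q a b (3 * (n : ℕ))
      * q ^ ((9 * (n : ℤ) ^ 2 - 9 * (n : ℤ)) / 2)) ∧
    Summable (fun n : ℕ+ => (-1 : ℂ) ^ (n : ℕ) * rhsFactor q a b (3 * (n : ℕ) - 1)
      * q ^ ((9 * (n : ℤ) ^ 2 - 15 * (n : ℤ)) / 2)) ∧
    Summable (fun n : ℕ => (-1 : ℂ) ^ n * rhsFactor q a b (3 * n + 1)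
      * q ^ ((9 * (n : ℤ) ^ 2 - 3 * (n : ℤ)) / 2)) ∧
    qPochsInf [q, a * b / q] q / qPochsInf [a, b] q * ∑' n : ℕ, lhsTerm q s a b ω n
      = 1
        + ∑' n : ℕ+, (-1 : ℂ) ^ (n : ℕ) * rhsFactor q a b (3 * (n : ℕ))
            * q ^ ((9 * (n : ℤ) ^ 2 - 9 * (n : ℤ)) / 2)
        + q ^ 2 / 2 * ∑' n : ℕ+, (-1 : ℂ) ^ (n : ℕ) * rhsFactor q a b (3 * (n : ℕ) - 1)
            * q ^ ((9 * (n : ℤ) ^ 2 - 15 * (n : ℤ)) / 2)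
        + 1 / (2 * q) * ∑' n : ℕ, (-1 : ℂ) ^ n * rhsFactor q a b (3 * n + 1)
            * q ^ ((9 * (n : ℤ) ^ 2 - 3 * (n : ℤ)) / 2) := by
  obtain ⟨⟨ha, hb⟩, hx⟩ := by simpa only [max_lt_iff] using hab
  have hprim : IsPrimitiveRoot ω 3 := by
    rw [hω]; exact_mod_cast Complex.isPrimitiveRoot_exp 3 three_ne_zero
  exact mainTheorem11_general q s a b ω hq0 hq hs ha0 hb0
    (mul_pow_ne_one_of_norm_lt_one ha hq.le) (mul_pow_ne_one_of_norm_lt_one hb hq.le) hx hprim
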